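/- There is an absolute constant $c>0$ such that for every finite set $A\subset\mathbb{R}$ with $|A|\ge 2$ there exist elements $a,a'\in A$ (not necessarily distinct) with $$|(A-a)(A-a')|\;\ge\; c\,\frac{|A|^2}{\log|A|},$$ where $(A-a)(A-a')=\{(x-a)(y-a') : x,y\in A\}$. As a consequence, there is an absolute constant $c>0$ such that for every finite set $A\subset\mathbb{R}$ with $|A|\ge 2$, $$|(A-A)(A-A)|\;\ge\; c\,\frac{|A|^2}{\log|A|},$$ where $(A-A)(A-A)=\{(x-y)(z-w) : x,y,z,w\in A\}$. -/

import Mathlib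

open scoped Pointwise

/-! The multiplicative energies of A-a and A-b, with 0 removed and summed over all a, b in A, are at
most the number of collinear triples in A × A on lines not parallel to an axis. If that number is
O(n^4 log n), where n = |A|, some pair (a, b) has energy O(n^2 log n), and Cauchy-Schwarz makes its
product set large.

Triples are bounded without incidence geometry. For each r ≤ n, cut A into at most r blocks. A line
with m points meets at most 2r-1 cells of the grid, so it has at least m-(2r-1) ordered pairs of
distinct points sharing a cell; over all lines there are O(n^4/r^2) such pairs. Weighting by r and
summing over r gives order m^3 for each line (`cube_le_sum_Icc`) against a harmonic sum, the source
of the logarithm. -/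

/-- The number of elements of `A` below `x`. -/
noncomputable def rankIn (A : Finset ℝ) (x : ℝ) : ℕ := (A.filter (· < x)).card

lemma rankIn_mono (A : Finset ℝ) : Monotone (rankIn A) := fun _ _ h =>
  Finset.card_le_card (Finset.monotone_filter_right A (fun _ _ hc => lt_of_lt_of_le hc h))

lemma rankIn_lt_of_lt {A : Finset ℝ} {x y : ℝ} (hx : x ∈ A) (h : x < y) :
    rankIn A x < rankIn A y := by
  refine Finset.card_lt_card (Finset.ssubset_iff_of_subset
    (Finset.monotone_filter_right A (fun _ _ hc => lt_trans hc h)) |>.2 ⟨x, ?_, ?_⟩)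
  · simp [hx, h]
  · simp

lemma rankIn_injOn (A : Finset ℝ) : Set.InjOn (rankIn A) A := by
  intro x hx y hy h
  rcases lt_trichotomy x y with hl | hl | hl
  · exact absurd h (rankIn_lt_of_lt hx hl).ne
  · exact hl
  · exact absurd h (rankIn_lt_of_lt hy hl).ne'

lemma rankIn_lt_card {A : Finset ℝ} {x : ℝ} (hx : x ∈ A) : rankIn A x < A.card :=
  Finset.card_lt_card (Finset.filter_ssubset.2 ⟨x, hx, lt_irrefl x⟩)

/-- The index of the block of `x` when `A` is cut into blocks of `q` consecutive elements. -/
noncomputable def blockIn (A : Finset ℝ) (q : ℕ) (x : ℝ) : ℕ := rankIn A x / q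

lemma blockIn_mono (A : Finset ℝ) (q : ℕ) : Monotone (blockIn A q) := fun _ _ h =>
  Nat.div_le_div_right (rankIn_mono A h)

lemma blockIn_lt {A : Finset ℝ} {r : ℕ} (hr : 0 < r) {x : ℝ} (hx : x ∈ A) :
    blockIn A (A.card / r + 1) x < r := by
  refine (Nat.div_lt_iff_lt_mul (Nat.succ_pos _)).2 ((rankIn_lt_card hx).trans ?_)
  exact Nat.lt_mul_div_succ _ hr

/-- Pairs of elements of `A` in a common block. -/
noncomputable def blockPairs (A : Finset ℝ) (q : ℕ) : Finset (ℝ × ℝ) :=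
  (A ×ˢ A).filter (fun p => blockIn A q p.1 = blockIn A q p.2)

lemma card_block_le (A : Finset ℝ) {q : ℕ} (hq : 0 < q) (j : ℕ) :
    (A.filter (fun y => j = blockIn A q y)).card ≤ q := by
  have h : (A.filter (fun y => j = blockIn A q y)).card ≤ (Finset.Ico (q * j) (q * j + q)).card := by
    refine Finset.card_le_card_of_injOn (rankIn A) ?_ ?_
    · intro y hy
      obtain ⟨-, hy⟩ := Finset.mem_filter.1 hy
      have h1 := Nat.div_add_mod (rankIn A y) q
      have h2 := Nat.mod_lt (rankIn A y) hq
      have h3 : rankIn A y / q = j := hy.symm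
      rw [h3] at h1
      simp only [Finset.coe_Ico, Set.mem_Ico]
      omega
    · exact (rankIn_injOn A).mono (fun y hy => (Finset.mem_filter.1 hy).1)
  simpa using h

lemma card_blockPairs_le (A : Finset ℝ) {q : ℕ} (hq : 0 < q) :
    (blockPairs A q).card ≤ A.card * q := by
  rw [blockPairs, Finset.card_filter, Finset.sum_product, ← smul_eq_mul]
  refine Finset.sum_le_card_nsmul _ _ _ (fun x _ => ?_)
  rw [← Finset.card_filter]
  exact card_block_le A hq (blockIn A q x)

/-! ### Pairs on a line sharing a grid cell -/

/-- Ordered pairs of distinct elements with equal keys are at least as numerous as the excess of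
elements over keys. -/
lemma card_le_card_collisions_add {α κ : Type*} [DecidableEq α] [DecidableEq κ]
    (S : Finset α) (T : Finset κ) (f : α → κ) (hf : ∀ x ∈ S, f x ∈ T) :
    S.card ≤ ((S ×ˢ S).filter (fun p => p.1 ≠ p.2 ∧ f p.1 = f p.2)).card + T.card := by
  rcases S.eq_empty_or_nonempty with rfl | ⟨x₀, hx₀⟩
  · simp
  have hrep : ∀ k, ∃ z, (∃ x ∈ S, f x = k) → z ∈ S ∧ f z = k := by
    intro k
    by_cases h : ∃ x ∈ S, f x = k
    · obtain ⟨x, hx, hk⟩ := h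
      exact ⟨x, fun _ => ⟨hx, hk⟩⟩
    · exact ⟨x₀, fun h' => absurd h' h⟩
  choose g hg using hrep
  -- Pair each element with its key's representative; the representatives themselves inject into
  -- `T`.
  rw [← Finset.card_filter_add_card_filter_not (s := S) (fun x => x ≠ g (f x))]
  refine add_le_add ?_ ?_
  · refine Finset.card_le_card_of_injOn (fun x => (x, g (f x))) ?_ ?_
    · intro x hx
      obtain ⟨hx, hne⟩ := Finset.mem_filter.1 hx
      obtain ⟨h1, h2⟩ := hg (f x) ⟨x, hx, rfl⟩
      exact Finset.mem_filter.2 ⟨Finset.mem_product.2 ⟨hx, h1⟩, hne, h2.symm⟩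
    · intro x _ y _ h
      exact (Prod.ext_iff.1 h).1
  · refine Finset.card_le_card_of_injOn f ?_ ?_
    · intro x hx
      exact hf x (Finset.mem_filter.1 hx).1
    · intro x hx y hy h
      have hx' := (Finset.mem_filter.1 hx).2
      have hy' := (Finset.mem_filter.1 hy).2
      rw [not_not] at hx' hy'
      rw [hx', hy', h]

/-- The abscissae of the points of `A × A` on the line with slope `l.1` and intercept `l.2`. -/
noncomputable def lineAbscissae (A : Finset ℝ) (l : ℝ × ℝ) : Finset ℝ :=
  A.filter (fun x => l.1 * x + l.2 ∈ A)

/-- Ordered pairs of distinct points of `A × A` on the line `l` in a common cell of the grid of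
blocks of length `q`, given by their abscissae. -/
noncomputable def cellPairs (A : Finset ℝ) (q : ℕ) (l : ℝ × ℝ) : Finset (ℝ × ℝ) :=
  (lineAbscissae A l ×ˢ lineAbscissae A l).filter (fun p => p.1 ≠ p.2 ∧
    blockIn A q p.1 = blockIn A q p.2 ∧
    blockIn A q (l.1 * p.1 + l.2) = blockIn A q (l.1 * p.2 + l.2))

/-- A line that is not parallel to an axis meets at most `2 * r - 1` cells of an `r × r` grid. -/
lemma card_lineAbscissae_lt {A : Finset ℝ} {r : ℕ} (hr : 0 < r) {l : ℝ × ℝ} (hl : l.1 ≠ 0) :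
    (lineAbscissae A l).card + 1 ≤ (cellPairs A (A.card / r + 1) l).card + 2 * r := by
  set q := A.card / r + 1 with hq
  have hmem : ∀ x ∈ lineAbscissae A l, blockIn A q x < r ∧ blockIn A q (l.1 * x + l.2) < r := by
    intro x hx
    obtain ⟨h1, h2⟩ := Finset.mem_filter.1 hx
    exact ⟨blockIn_lt hr h1, blockIn_lt hr h2⟩
  have hkey : ∃ (f : ℝ → ℤ) (u : ℤ), (∀ x ∈ lineAbscissae A l, f x ∈ Finset.Ico u (u + (2 * r - 1))) ∧
      ∀ x ∈ lineAbscissae A l, ∀ y ∈ lineAbscissae A l, f x = f y → x ≤ y →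
        blockIn A q x = blockIn A q y ∧
        blockIn A q (l.1 * x + l.2) = blockIn A q (l.1 * y + l.2) := by
    -- Along a line both block indices are monotone, so their difference (negative slope) or sum
    -- (positive slope) determines the cell; it takes at most 2r-1 values.
    rcases lt_or_gt_of_ne hl with hneg | hpos
    · refine ⟨fun x => (blockIn A q x : ℤ) - blockIn A q (l.1 * x + l.2), -(r - 1), ?_, ?_⟩
      · intro x hx
        have := hmem x hx
        rw [Finset.mem_Ico]
        beta_reduce
        omega
      · intro x _ y _ h hxy
        have h1 := blockIn_mono A q hxy
        have h2 := blockIn_mono A q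
          (show l.1 * y + l.2 ≤ l.1 * x + l.2 by nlinarith)
        simp only at h
        omega
    · refine ⟨fun x => (blockIn A q x : ℤ) + blockIn A q (l.1 * x + l.2), 0, ?_, ?_⟩
      · intro x hx
        have := hmem x hx
        rw [Finset.mem_Ico]
        beta_reduce
        omega
      · intro x _ y _ h hxy
        have h1 := blockIn_mono A q hxy
        have h2 := blockIn_mono A q
          (show l.1 * x + l.2 ≤ l.1 * y + l.2 by nlinarith)
        simp only at h
        omega
  obtain ⟨f, u, hfu, hf⟩ := hkey
  have h := card_le_card_collisions_add (lineAbscissae A l) _ f hfu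
  have hsub : ((lineAbscissae A l ×ˢ lineAbscissae A l).filter
      (fun p => p.1 ≠ p.2 ∧ f p.1 = f p.2)) ⊆ cellPairs A q l := by
    intro p hp
    obtain ⟨hp, hne, hfe⟩ := Finset.mem_filter.1 hp
    obtain ⟨h1, h2⟩ := Finset.mem_product.1 hp
    refine Finset.mem_filter.2 ⟨hp, hne, ?_⟩
    rcases le_total p.1 p.2 with hle | hle
    · exact hf _ h1 _ h2 hfe hle
    · have := hf _ h2 _ h1 hfe.symm hle
      exact ⟨this.1.symm, this.2.symm⟩
  have h3 := Finset.card_le_card hsub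
  rw [Int.card_Ico] at h
  omega

/-- Two distinct points determine a line, so the pairs counted by `cellPairs` for different lines
are different pairs of points of `A × A` in a common cell. -/
lemma sum_card_cellPairs_le (A : Finset ℝ) {q : ℕ} (hq : 0 < q) (L : Finset (ℝ × ℝ)) :
    ∑ l ∈ L, (cellPairs A q l).card ≤ (A.card * q) ^ 2 := by
  rw [← Finset.card_sigma]
  have h : (L.sigma (fun l => cellPairs A q l)).card ≤
      (blockPairs A q ×ˢ blockPairs A q).card := by
    refine Finset.card_le_card_of_injOn
      (fun z => (z.2, (z.1.1 * z.2.1 + z.1.2, z.1.1 * z.2.2 + z.1.2))) ?_ ?_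
    · rintro ⟨l, p⟩ hz
      obtain ⟨-, hp⟩ := Finset.mem_sigma.1 hz
      obtain ⟨hp, -, hb1, hb2⟩ := Finset.mem_filter.1 hp
      obtain ⟨h1, h2⟩ := Finset.mem_product.1 hp
      obtain ⟨h1, h1'⟩ := Finset.mem_filter.1 h1
      obtain ⟨h2, h2'⟩ := Finset.mem_filter.1 h2
      exact Finset.mem_product.2 ⟨Finset.mem_filter.2 ⟨Finset.mem_product.2 ⟨h1, h2⟩, hb1⟩,
        Finset.mem_filter.2 ⟨Finset.mem_product.2 ⟨h1', h2'⟩, hb2⟩⟩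
    · rintro ⟨⟨s, t⟩, ⟨x, x'⟩⟩ hz ⟨⟨s', t'⟩, ⟨y, y'⟩⟩ _ h
      obtain ⟨-, hp⟩ := Finset.mem_sigma.1 hz
      have hne : x ≠ x' := (Finset.mem_filter.1 hp).2.1
      simp only [Prod.mk.injEq] at h
      obtain ⟨⟨rfl, rfl⟩, h1, h2⟩ := h
      have hs : s = s' := by
        have : (s - s') * (x - x') = 0 := by linear_combination h1 - h2
        rcases mul_eq_zero.1 this with h | h
        · linarith
        · exact absurd (sub_eq_zero.1 h) hne
      subst hs
      have ht : t = t' := by linarith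
      rw [ht]
  refine h.trans ?_
  rw [Finset.card_product, sq]
  exact Nat.mul_le_mul (card_blockPairs_le A hq) (card_blockPairs_le A hq)

/-! ### Counting collinear triples -/

lemma sum_Icc_mul_add (k : ℕ) (D : ℕ → ℕ) (h : ∀ r ∈ Finset.Icc 1 k, 2 * k + 1 ≤ D r + 2 * r) :
    k * (k + 1) * (2 * k + 1) ≤ 6 * ∑ r ∈ Finset.Icc 1 k, r * D r := by
  have h1 : ∀ j : ℕ, (6 : ℤ) * ∑ r ∈ Finset.Icc 1 j, (r : ℤ) * (2 * k + 1 - 2 * r) =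
      3 * (2 * k + 1) * (j * (j + 1)) - 2 * (j * (j + 1) * (2 * j + 1)) := by
    intro j
    induction j with
    | zero => simp
    | succ j ih =>
      rw [Finset.sum_Icc_succ_top (by omega), mul_add, ih]
      push_cast
      ring
  have h2 : ∑ r ∈ Finset.Icc 1 k, (r : ℤ) * (2 * k + 1 - 2 * r) ≤
      ∑ r ∈ Finset.Icc 1 k, (r : ℤ) * D r := by
    refine Finset.sum_le_sum (fun r hr => mul_le_mul_of_nonneg_left ?_ (by positivity))
    have := h r hr
    omega
  have h3 := h1 k
  zify
  linarith

/-- Only r ≤ m/2, where the lower bound on `D r` is positive, is used. -/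
lemma cube_le_sum_Icc {m n : ℕ} (hm : 2 ≤ m) (hmn : m ≤ n) (D : ℕ → ℕ)
    (h : ∀ r ∈ Finset.Icc 1 n, m + 1 ≤ D r + 2 * r) :
    m ^ 3 ≤ 27 * ∑ r ∈ Finset.Icc 1 n, r * D r := by
  obtain ⟨k, hk⟩ : ∃ k, k = m / 2 := ⟨_, rfl⟩
  have h1 := sum_Icc_mul_add k D (fun r hr => by
    rw [Finset.mem_Icc] at hr
    have := h r (Finset.mem_Icc.2 ⟨hr.1, by omega⟩)
    omega)
  have h2 : ∑ r ∈ Finset.Icc 1 k, r * D r ≤ ∑ r ∈ Finset.Icc 1 n, r * D r :=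
    Finset.sum_le_sum_of_subset (Finset.Icc_subset_Icc_right (by omega))
  have h3 : m ^ 3 ≤ (2 * k + 1) ^ 3 := Nat.pow_le_pow_left (by omega) 3
  have hk1 : 1 ≤ k := by omega
  have h4 : 2 * (2 * k + 1) ^ 3 ≤ 9 * (k * (k + 1) * (2 * k + 1)) := by
    have : 2 * (2 * k + 1) ^ 2 ≤ 9 * (k * (k + 1)) := by nlinarith
    calc 2 * (2 * k + 1) ^ 3 = 2 * (2 * k + 1) ^ 2 * (2 * k + 1) := by ring
      _ ≤ 9 * (k * (k + 1)) * (2 * k + 1) := Nat.mul_le_mul_right _ this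
      _ = _ := by ring
  omega

/-- The number of collinear triples in `A × A` on lines not parallel to an axis. -/
lemma sum_card_lineAbscissae_cube_le (A : Finset ℝ) (L : Finset (ℝ × ℝ))
    (hL : ∀ l ∈ L, l.1 ≠ 0 ∧ 2 ≤ (lineAbscissae A l).card) :
    ((∑ l ∈ L, (lineAbscissae A l).card ^ 3 : ℕ) : ℝ) ≤
      108 * (A.card : ℝ) ^ 4 * (1 + Real.log A.card) := by
  set n := A.card with hn
  have h1 : ∑ l ∈ L, (lineAbscissae A l).card ^ 3 ≤
      27 * ∑ r ∈ Finset.Icc 1 n, r * ∑ l ∈ L, (cellPairs A (n / r + 1) l).card := by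
    simp_rw [Finset.mul_sum]
    rw [Finset.sum_comm]
    refine Finset.sum_le_sum (fun l hl => ?_)
    rw [← Finset.mul_sum]
    refine cube_le_sum_Icc (hL l hl).2 (Finset.card_filter_le _ _)
      (fun r => (cellPairs A (n / r + 1) l).card) (fun r hr => ?_)
    exact card_lineAbscissae_lt (Finset.mem_Icc.1 hr).1 (hL l hl).1
  have h2 : ∀ r ∈ Finset.Icc 1 n,
      ((r * ∑ l ∈ L, (cellPairs A (n / r + 1) l).card : ℕ) : ℝ) ≤ 4 * (n : ℝ) ^ 4 * (r : ℝ)⁻¹ := by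
    intro r hr
    obtain ⟨hr1, hrn⟩ := Finset.mem_Icc.1 hr
    have hS := sum_card_cellPairs_le A (Nat.succ_pos (n / r)) L
    have hq : (n / r + 1) * r ≤ 2 * n := by
      have := Nat.div_mul_le_self n r
      rw [add_mul]
      omega
    have hr0 : (0 : ℝ) < r := by exact_mod_cast hr1
    rw [← div_eq_mul_inv, le_div_iff₀ hr0]
    have : r * (∑ l ∈ L, (cellPairs A (n / r + 1) l).card) * r ≤ 4 * n ^ 4 := by
      calc r * (∑ l ∈ L, (cellPairs A (n / r + 1) l).card) * r
          ≤ r * (n * (n / r + 1)) ^ 2 * r := by gcongr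
        _ = n ^ 2 * ((n / r + 1) * r) ^ 2 := by ring
        _ ≤ n ^ 2 * (2 * n) ^ 2 := by gcongr
        _ = 4 * n ^ 4 := by ring
    exact_mod_cast this
  have h3 : ∑ r ∈ Finset.Icc 1 n, ((r : ℝ))⁻¹ ≤ 1 + Real.log n := by
    have := harmonic_le_one_add_log n
    rw [harmonic_eq_sum_Icc] at this
    push_cast at this
    exact this
  calc ((∑ l ∈ L, (lineAbscissae A l).card ^ 3 : ℕ) : ℝ)
      ≤ ((27 * ∑ r ∈ Finset.Icc 1 n, r * ∑ l ∈ L, (cellPairs A (n / r + 1) l).card : ℕ) : ℝ) := by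
        exact_mod_cast h1
    _ = 27 * ∑ r ∈ Finset.Icc 1 n,
          ((r * ∑ l ∈ L, (cellPairs A (n / r + 1) l).card : ℕ) : ℝ) := by push_cast; rfl
    _ ≤ 27 * ∑ r ∈ Finset.Icc 1 n, 4 * (n : ℝ) ^ 4 * (r : ℝ)⁻¹ := by
        gcongr with r hr
        exact h2 r hr
    _ = 108 * (n : ℝ) ^ 4 * ∑ r ∈ Finset.Icc 1 n, (r : ℝ)⁻¹ := by
        rw [← Finset.mul_sum]; ring
    _ ≤ _ := by gcongr

/-! ### From energy to lines -/

/-- The slope and intercept of the line through two points with different abscissae. -/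
noncomputable def lineThrough (p q : ℝ × ℝ) : ℝ × ℝ :=
  ((q.2 - p.2) / (q.1 - p.1), p.2 - (q.2 - p.2) / (q.1 - p.1) * p.1)

/-- The lines, not parallel to an axis, through two points of `A × A`. -/
noncomputable def gridLines (A : Finset ℝ) : Finset (ℝ × ℝ) :=
  (((A ×ˢ A) ×ˢ (A ×ˢ A)).filter (fun z => z.2.1 ≠ z.1.1 ∧ z.2.2 ≠ z.1.2)).image
    (fun z => lineThrough z.1 z.2)

lemma lineThrough_left (p q : ℝ × ℝ) :
    (lineThrough p q).1 * p.1 + (lineThrough p q).2 = p.2 := by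
  simp [lineThrough]

lemma lineThrough_eq_iff {p q : ℝ × ℝ} (h : q.1 ≠ p.1) (x y : ℝ) :
    (lineThrough p q).1 * x + (lineThrough p q).2 = y ↔
      (q.2 - p.2) * (x - p.1) = (y - p.2) * (q.1 - p.1) := by
  have h' : q.1 - p.1 ≠ 0 := sub_ne_zero.2 h
  simp only [lineThrough]
  constructor
  · rintro rfl
    field_simp
    ring
  · intro h
    have : (q.2 - p.2) / (q.1 - p.1) * (x - p.1) = y - p.2 := by
      rw [div_mul_eq_mul_div, h, mul_div_cancel_right₀ _ h']
    linarith

lemma two_le_card_lineAbscissae {A : Finset ℝ} {l : ℝ × ℝ} (hl : l ∈ gridLines A) :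
    l.1 ≠ 0 ∧ 2 ≤ (lineAbscissae A l).card := by
  obtain ⟨⟨p, q⟩, hz, rfl⟩ := Finset.mem_image.1 hl
  simp only [Finset.mem_filter, Finset.mem_product] at hz
  obtain ⟨⟨⟨hp1, hp2⟩, hq1, hq2⟩, h1, h2⟩ := hz
  refine ⟨div_ne_zero (sub_ne_zero.2 h2) (sub_ne_zero.2 h1), ?_⟩
  refine Nat.succ_le_of_lt (Finset.one_lt_card.2 ⟨p.1, ?_, q.1, ?_, h1.symm⟩)
  · refine Finset.mem_filter.2 ⟨hp1, ?_⟩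
    rw [lineThrough_left]
    exact hp2
  · refine Finset.mem_filter.2 ⟨hq1, ?_⟩
    rw [(lineThrough_eq_iff h1 q.1 q.2).2 rfl]
    exact hq2

/-- The nonzero elements of `A - a`, for `a ∈ A`. -/
noncomputable def punctured (A : Finset ℝ) (a : ℝ) : Finset ℝ := (A.erase a).image (· - a)

lemma mem_punctured {A : Finset ℝ} {a u : ℝ} : u ∈ punctured A a ↔ u ≠ 0 ∧ u + a ∈ A := by
  simp only [punctured, Finset.mem_image, Finset.mem_erase]
  constructor
  · rintro ⟨x, ⟨hne, hx⟩, rfl⟩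
    exact ⟨sub_ne_zero.2 hne, by simpa using hx⟩
  · rintro ⟨h0, hu⟩
    exact ⟨u + a, ⟨by simpa using h0, hu⟩, by ring⟩

lemma card_punctured {A : Finset ℝ} {a : ℝ} (ha : a ∈ A) :
    (punctured A a).card = A.card - 1 := by
  rw [punctured, Finset.card_image_of_injective _ (sub_left_injective), Finset.card_erase_of_mem ha]

/-- Coincidences among products `u * v` with `u ∈ A - a`, `v ∈ A - b` correspond to collinear
triples in `A × A` containing `(a, b)`. -/
lemma sum_mulEnergy_le (A : Finset ℝ) :
    ∑ p ∈ A ×ˢ A, Finset.mulEnergy (punctured A p.1) (punctured A p.2) ≤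
      ∑ l ∈ gridLines A, (lineAbscissae A l).card ^ 3 := by
  have hcube : ∀ l, (lineAbscissae A l).card ^ 3 =
      (lineAbscissae A l ×ˢ lineAbscissae A l ×ˢ lineAbscissae A l).card := by
    intro l
    simp only [Finset.card_product]
    ring
  simp_rw [hcube, Finset.mulEnergy]
  rw [← Finset.card_sigma, ← Finset.card_sigma]
  -- When u v = u' v', the points (a, b), (a+u, b+v'), (a+u', b+v) are collinear; the line and the
  -- abscissae determine them.
  refine Finset.card_le_card_of_injOn
    (fun z => ⟨lineThrough z.1 (z.1.1 + z.2.1.1, z.1.2 + z.2.2.2),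
      (z.1.1, z.1.1 + z.2.1.1, z.1.1 + z.2.1.2)⟩) ?_ ?_
  · rintro ⟨⟨a, b⟩, ⟨⟨u, u'⟩, ⟨v, v'⟩⟩⟩ hz
    simp only [Finset.coe_sigma, Set.mem_sigma_iff, Finset.mem_coe, Finset.mem_product,
      Finset.mem_filter, mem_punctured] at hz
    obtain ⟨⟨ha, hb⟩, ⟨⟨⟨hu0, hu⟩, hu0', hu'⟩, ⟨hv0, hv⟩, hv0', hv'⟩, he⟩ := hz
    rw [add_comm] at hu hu' hv hv'
    have hne : a + u ≠ a := by simpa using hu0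
    have hmem : ∀ x ∈ A, ∀ y ∈ A, v' * (x - a) = (y - b) * u →
        x ∈ lineAbscissae A (lineThrough (a, b) (a + u, b + v')) := by
      intro x hx y hy h
      refine Finset.mem_filter.2 ⟨hx, ?_⟩
      rw [(lineThrough_eq_iff (p := (a, b)) (q := (a + u, b + v')) hne x y).2 (by simpa using h)]
      exact hy
    refine Finset.mem_sigma.2 ⟨Finset.mem_image.2 ⟨((a, b), (a + u, b + v')), ?_, rfl⟩, ?_⟩
    · simp only [Finset.mem_filter, Finset.mem_product]
      exact ⟨⟨⟨ha, hb⟩, hu, hv'⟩, hne, by simpa using hv0'⟩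
    · refine Finset.mem_product.2 ⟨hmem a ha b hb (by ring), Finset.mem_product.2
        ⟨hmem _ hu _ hv' (by ring), hmem _ hu' _ hv ?_⟩⟩
      simp only [add_sub_cancel_left]
      linear_combination -he
  · rintro ⟨⟨a, b⟩, ⟨⟨u, u'⟩, ⟨v, v'⟩⟩⟩ hz ⟨⟨c, d⟩, ⟨⟨w, w'⟩, ⟨y, y'⟩⟩⟩ hz' h
    simp only [Finset.coe_sigma, Set.mem_sigma_iff, Finset.mem_coe, Finset.mem_product,
      Finset.mem_filter, mem_punctured] at hz hz'
    obtain ⟨-, ⟨⟨⟨hu0, -⟩, -, -⟩, -⟩, he⟩ := hz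
    obtain ⟨-, -, he'⟩ := hz'
    simp only [Sigma.mk.injEq, heq_eq_eq, Prod.mk.injEq] at h
    obtain ⟨hl, rfl, h1, h2⟩ := h
    obtain rfl := add_left_cancel h1
    obtain rfl := add_left_cancel h2
    have hb := lineThrough_left (a, b) (a + u, b + v')
    rw [hl] at hb
    have hd := lineThrough_left (a, d) (a + u, d + y')
    simp only at hb hd
    obtain rfl : b = d := hb.symm.trans hd
    have hs : v' = y' := by
      have := (Prod.ext_iff.1 hl).1
      simp only [lineThrough, add_sub_cancel_left] at this
      exact (div_left_inj' hu0).1 this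
    subst hs
    obtain rfl : v = y := mul_left_cancel₀ hu0 (he.trans he'.symm)
    rfl

/-! ### Pigeonhole and Cauchy-Schwarz -/

/-- Some pair of translates has small multiplicative energy, hence a large product set. -/
lemma exists_large_card_sub_mul_sub (A : Finset ℝ) (hA : 2 ≤ A.card) :
    ∃ a ∈ A, ∃ a' ∈ A, (1 / 5184 : ℝ) * ((A.card : ℝ) ^ 2 / Real.log (A.card : ℝ)) ≤
      (((A - {a}) * (A - {a'})).card : ℝ) := by
  set n := A.card with hn
  have hn2 : (2 : ℝ) ≤ n := by exact_mod_cast hA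
  have hlog : (1 : ℝ) / 2 ≤ Real.log n := by
    have := Real.log_two_gt_d9
    have := Real.log_le_log (by norm_num) hn2
    linarith
  have hne : (A ×ˢ A).Nonempty := by
    have : A.Nonempty := Finset.card_pos.1 (by omega)
    exact this.product this
  have hsum : ((∑ p ∈ A ×ˢ A, Finset.mulEnergy (punctured A p.1) (punctured A p.2) : ℕ) : ℝ) ≤
      324 * (n : ℝ) ^ 4 * Real.log n := by
    calc _ ≤ ((∑ l ∈ gridLines A, (lineAbscissae A l).card ^ 3 : ℕ) : ℝ) := by
          exact_mod_cast sum_mulEnergy_le A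
      _ ≤ 108 * (n : ℝ) ^ 4 * (1 + Real.log n) :=
          sum_card_lineAbscissae_cube_le A _ (fun l hl => two_le_card_lineAbscissae hl)
      _ ≤ 108 * (n : ℝ) ^ 4 * (3 * Real.log n) := by gcongr; linarith
      _ = _ := by ring
  obtain ⟨⟨a, b⟩, hp, hE⟩ : ∃ p ∈ A ×ˢ A,
      (Finset.mulEnergy (punctured A p.1) (punctured A p.2) : ℝ) ≤
        324 * (n : ℝ) ^ 2 * Real.log n := by
    refine Finset.exists_le_of_sum_le hne ?_
    rw [Finset.sum_const, Finset.card_product, nsmul_eq_mul]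
    push_cast at hsum ⊢
    refine hsum.trans (le_of_eq ?_)
    ring
  obtain ⟨ha, hb⟩ := Finset.mem_product.1 hp
  refine ⟨a, ha, b, hb, ?_⟩
  have hsub : ∀ c, punctured A c ⊆ A - {c} := by
    intro c u hu
    obtain ⟨x, hx, rfl⟩ := Finset.mem_image.1 hu
    exact Finset.sub_mem_sub (Finset.mem_of_mem_erase hx) (Finset.mem_singleton_self c)
  have hcard : ((punctured A a * punctured A b).card : ℝ) ≤ ((A - {a}) * (A - {b})).card := by
    exact_mod_cast Finset.card_le_card (Finset.mul_subset_mul (hsub a) (hsub b))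
  refine le_trans ?_ hcard
  have hCS := Finset.le_card_mul_mul_mulEnergy (punctured A a) (punctured A b)
  rw [card_punctured ha, card_punctured hb] at hCS
  have hCS' : ((n : ℝ) - 1) ^ 2 * ((n : ℝ) - 1) ^ 2 ≤
      (punctured A a * punctured A b).card *
        Finset.mulEnergy (punctured A a) (punctured A b) := by
    have h1 : ((n - 1 : ℕ) : ℝ) = (n : ℝ) - 1 := by
      rw [Nat.cast_sub (by omega)]; simp
    rw [← h1]
    exact_mod_cast hCS
  set P : ℝ := ((punctured A a * punctured A b).card : ℝ) with hP
  have hP0 : 0 ≤ P := Nat.cast_nonneg _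
  -- Since n ≥ 2, n-1 ≥ n/2; the final constant is 5184 = 16 · 324.
  have hsq : (n : ℝ) ^ 2 / 4 ≤ ((n : ℝ) - 1) ^ 2 := by nlinarith
  have hmain : (n : ℝ) ^ 2 / 4 * ((n : ℝ) ^ 2 / 4) ≤ P * (324 * (n : ℝ) ^ 2 * Real.log n) :=
    calc _ ≤ ((n : ℝ) - 1) ^ 2 * ((n : ℝ) - 1) ^ 2 := by gcongr
      _ ≤ _ := hCS'
      _ ≤ _ := mul_le_mul_of_nonneg_left hE hP0
  have hlog0 : 0 < Real.log n := by linarith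
  rw [← mul_div_assoc, div_le_iff₀ hlog0]
  have hn0 : (0 : ℝ) < (n : ℝ) ^ 2 := by positivity
  refine le_of_mul_le_mul_right ?_ hn0
  linarith

theorem theorem1 :
    (∃ c : ℝ, 0 < c ∧ ∀ A : Finset ℝ, 2 ≤ A.card →
      ∃ a ∈ A, ∃ a' ∈ A,
        c * ((A.card : ℝ) ^ 2 / Real.log (A.card : ℝ)) ≤
          (((A - {a}) * (A - {a'})).card : ℝ)) ∧
    (∃ c : ℝ, 0 < c ∧ ∀ A : Finset ℝ, 2 ≤ A.card →
      c * ((A.card : ℝ) ^ 2 / Real.log (A.card : ℝ)) ≤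
        (((A - A) * (A - A)).card : ℝ)) := by
  refine ⟨⟨1 / 5184, by norm_num, exists_large_card_sub_mul_sub⟩, 1 / 5184, by norm_num, ?_⟩
  intro A hA
  obtain ⟨a, ha, a', ha', h⟩ := exists_large_card_sub_mul_sub A hA
  refine h.trans ?_
  have hsub : ∀ c ∈ A, A - {c} ⊆ A - A := fun c hc =>
    Finset.sub_subset_sub_left (Finset.singleton_subset_iff.2 hc)
  exact_mod_cast Finset.card_le_card (Finset.mul_subset_mul (hsub a ha) (hsub a' ha'))
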